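/- Let $(x,y)\in\mathbb{R}^d\times\{+1,-1\}$ be random with joint probability law $p(x,y)$. Let $\pi_+=p(y=+1)$ and $r(x)=p(y=+1\mid x)$. Let $\mathcal{G}$ be a class of measurable functions $g:\mathbb{R}^d\to\mathbb{R}$, all of whose suprema over samples are measurable, and let $\ell$ be a real function. Let $C_g,C_\ell,C_r>0$ and $L_\ell\ge 0$ be constants such that - $\sup_{x}|g(x)|\le C_g$ for every $g\in\mathcal{G}$; - $0\le \ell(z)\le C_\ell$ for all $|z|\le C_g$, and $\ell$ is $L_\ell$-Lipschitz on $[-C_g,C_g]$; - $r(x)\ge C_r$ for $p(x)$-almost every $x$. Write $R(g)=\mathbb{E}_{p(x,y)}[\ell(y\,g(x))]$ for the classification risk. For an i.i.d. sample $x_1,\dots,x_n$ ($n\ge1$) from $p(x\mid y=+1)$, with confidences $r_i=r(x_i)$, let $$\widehat R(g)=\frac{\pi_+}{n}\sum_{i=1}^n\Big[\ell(g(x_i))+\frac{1-r_i}{r_i}\,\ell(-g(x_i))\Big]$$ be the empirical Pconf (positive-confidence) risk. Suppose that $g^*\in\mathcal{G}$ minimizes $R$ over $\mathcal{G}$. Let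 $$\mathfrak{R}_n(\mathcal{G})=\mathbb{E}_{x_1,\dots,x_n}\mathbb{E}_{\sigma_1,\dots,\sigma_n}\Big[\sup_{g\in\mathcal{G}}\frac1n\sum_{i=1}^n\sigma_i g(x_i)\Big]$$ be the Rademacher complexity of $\mathcal{G}$, where the $x_i$ are i.i.d. from $p(x\mid y=+1)$ and the $\sigma_i$ are independent uniform random signs. (1) For every $n\ge 1$ and every $\delta>0$, with probability at least $1-\delta$ over the sample, every minimizer $\hat g$ of $\widehat R$ over $\mathcal{G}$ satisfies $$R(\hat g)-R(g^*)\le 4\pi_+\Big(L_\ell+\frac{L_\ell}{C_r}\Big)\mathfrak{R}_n(\mathcal{G})+2\pi_+\Big(C_\ell+\frac{C_\ell}{C_r}\Big)\sqrt{\frac{\ln(2/\delta)}{2n}}.$$ (2) Consequently the method is consistent whenever $\mathfrak{R}_n(\mathcal{G})\to0$: for every $\varepsilon>0$, the probability (outer measure) that some minimizer $\hat g$ of $\widehat R$ over $\mathcal{G}$ has $R(\hat g)-R(g^*)>\varepsilon$ tends to $0$ as $n\to\infty$. -/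

import Mathlib

open MeasureTheory ProbabilityTheory Set Filter Topology
open scoped NNReal ENNReal

noncomputable section

namespace Pconf

variable {E : Type*} [MeasurableSpace E]

/-- Labels are `1, -1 : ℤˣ`; `sgn y` is the label as a real number. -/
def sgn (y : ℤˣ) : ℝ := ((y : ℤ) : ℝ)

/-- The class prior `π₊ = p(y = +1)` of the joint law `μ` of `(x, y)`. -/
def prior (μ : Measure (E × ℤˣ)) : ℝ := μ.real (Prod.snd ⁻¹' {1})

/-- The law `p(x ∣ y = +1)` of a positive pattern. -/
def posDist (μ : Measure (E × ℤˣ)) : Measure E :=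
  (ProbabilityTheory.cond μ (Prod.snd ⁻¹' {1})).map Prod.fst

/-- `r` is a version of the positive confidence `x ↦ p(y = +1 ∣ x)`, the conditional probability
of the positive label given the pattern (`μ.fst` is the law `p(x)` of the pattern). -/
structure IsConfidence (μ : Measure (E × ℤˣ)) (r : E → ℝ) : Prop where
  measurable : Measurable r
  mem_Icc : ∀ x, r x ∈ Icc (0 : ℝ) 1
  measure_eq : ∀ A : Set E, MeasurableSet A →
    μ (A ×ˢ {1}) = ∫⁻ x in A, ENNReal.ofReal (r x) ∂μ.fst

/-- The classification risk `R(g) = 𝔼 ℓ(y g(x))`. -/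
def risk (μ : Measure (E × ℤˣ)) (ℓ : ℝ → ℝ) (g : E → ℝ) : ℝ :=
  ∫ p, ℓ (sgn p.2 * g p.1) ∂μ

/-- The empirical Pconf risk of `g` on the positive patterns `S 0, …, S (n - 1)` with
confidences `r (S i)`. -/
def empRisk (μ : Measure (E × ℤˣ)) (r : E → ℝ) (ℓ : ℝ → ℝ) {n : ℕ} (S : Fin n → E)
    (g : E → ℝ) : ℝ :=
  prior μ * ((1 / (n : ℝ)) *
    ∑ i, (ℓ (g (S i)) + (1 - r (S i)) / r (S i) * ℓ (-g (S i))))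

/-- `g` minimizes the functional `F` over the class `G`. -/
def IsMinimizer (F : (E → ℝ) → ℝ) (G : Set (E → ℝ)) (g : E → ℝ) : Prop :=
  g ∈ G ∧ ∀ h ∈ G, F g ≤ F h

/-- The law of `n` independent patterns with law `P`. -/
def sampleLaw (P : Measure E) (n : ℕ) : Measure (Fin n → E) :=
  Measure.pi fun _ => P

/-- The Rademacher complexity `𝔼_S 𝔼_σ sup_{g ∈ G} (1/n) ∑ᵢ σᵢ g(xᵢ)` for samples of size `n`
from `P`; the expectation over `n` independent Rademacher signs is the mean over `{1, -1}ⁿ`. -/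
def rademacher (P : Measure E) (G : Set (E → ℝ)) (n : ℕ) : ℝ :=
  ∫ S, (1 / (2 : ℝ) ^ n) * ∑ σ : Fin n → ℤˣ,
    ⨆ g : G, (1 / (n : ℝ)) * ∑ i, sgn (σ i) * (g : E → ℝ) (S i) ∂(sampleLaw P n)

/-- The usual measurability convention for suprema over a possibly uncountable class `G`: a
supremum over `g ∈ G` of a sum of terms depending on one sample point `xᵢ` and on `g(xᵢ)`
(measurably, and continuously in `g(xᵢ)`) is a random variable. It holds for
every countable class of measurable functions, and for every pointwise bounded class that has
a countable subclass from which each member is a pointwise limit of a sequence. -/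
def HasMeasurableSups (P : Measure E) (G : Set (E → ℝ)) : Prop :=
  ∀ (m : ℕ) (ψ : Fin m → E → ℝ → ℝ),
    (∀ i, Measurable (Function.uncurry (ψ i))) → (∀ i x, Continuous (ψ i x)) →
    AEMeasurable (fun S : Fin m → E => ⨆ g : G, ∑ i, ψ i (S i) ((g : E → ℝ) (S i)))
      (sampleLaw P m)

end Pconf

end

/-! Splitting the risk by label and dividing by the confidence writes it as `π₊` times the mean of
the loss `ℓ(g(x)) + ((1 - r(x)) / r(x)) ℓ(-g(x))` under `p(x ∣ y = +1)`; the Pconf risk is `π₊`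
times the empirical mean of this loss. The loss is bounded by `C_ℓ + C_ℓ / C_r` and, as a function
of `g(x)`, is Lipschitz with constant `L_ℓ + L_ℓ / C_r`.

The deviation of the means from their empirical values over a sample is at most the largest gap to
an independent ghost sample, averaged over the ghost sample. By McDiarmid's inequality this averaged
gap is close to its expectation, which symmetrization bounds by twice the Rademacher complexity of
the losses, and by Talagrand's contraction principle passing to the losses costs only the Lipschitz
constant. Applied to the loss and to its negative, each with probability `δ / 2`, this bounds the
deviations uniformly over the class, and comparing two members of the class doubles the bound. -/

namespace Pconf

section LowerMean

variable {α β : Type*} [MeasurableSpace α] [MeasurableSpace β] {μ : Measure α} {ν : Measure β}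
  {f g : β → ℝ}

/-- The lower mean of `f`: the supremum of the means of the integrable functions below `f`. It is
the mean of `f` when `f` is integrable, and it obeys pointwise bounds on `f` in any case, so it can
be applied to all sections of a function that is only almost everywhere measurable. -/
noncomputable def lowerMean (ν : Measure β) (f : β → ℝ) : ℝ :=
  sSup ((fun h => ∫ x, h x ∂ν) '' {h | Integrable h ν ∧ ∀ x, h x ≤ f x})

lemma lowerMean_eq_integral (hf : Integrable f ν) : lowerMean ν f = ∫ x, f x ∂ν := by
  refine IsGreatest.csSup_eq ⟨⟨f, ⟨hf, fun _ => le_rfl⟩, rfl⟩, ?_⟩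
  rintro _ ⟨h, ⟨hh, hle⟩, rfl⟩
  exact integral_mono hh hf hle

lemma lowerMean_le_add [IsProbabilityMeasure ν] {c : ℝ} (hf : BddBelow (range f))
    (hg : BddAbove (range g)) (hfg : ∀ x, f x ≤ g x + c) :
    lowerMean ν f ≤ lowerMean ν g + c := by
  obtain ⟨a, ha⟩ := hf
  obtain ⟨b, hb⟩ := hg
  have hbdd : BddAbove ((fun h => ∫ x, h x ∂ν) '' {h | Integrable h ν ∧ ∀ x, h x ≤ g x}) := by
    refine ⟨b, ?_⟩
    rintro _ ⟨h, ⟨hh, hle⟩, rfl⟩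
    simpa using integral_mono hh (integrable_const b) fun x => (hle x).trans (hb (mem_range_self x))
  refine csSup_le ⟨_, fun _ => a, ⟨integrable_const a, fun x => ha (mem_range_self x)⟩, rfl⟩ ?_
  rintro _ ⟨h, ⟨hh, hle⟩, rfl⟩
  have hsub : ∫ x, (h x - c) ∂ν ≤ lowerMean ν g :=
    le_csSup hbdd ⟨_, ⟨hh.sub (integrable_const c), fun x => sub_le_iff_le_add.2
      ((hle x).trans (hfg x))⟩, rfl⟩
  rw [integral_sub hh (integrable_const c)] at hsub
  simpa [sub_le_iff_le_add] using hsub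

variable [SFinite μ] [SFinite ν] {X : α × β → ℝ}

lemma ae_lowerMean_eq_integral (hX : Integrable X (μ.prod ν)) :
    ∀ᵐ a ∂μ, lowerMean ν (fun b => X (a, b)) = ∫ b, X (a, b) ∂ν :=
  hX.prod_right_ae.mono fun _ ha => lowerMean_eq_integral ha

lemma aemeasurable_lowerMean (hX : Integrable X (μ.prod ν)) :
    AEMeasurable (fun a => lowerMean ν fun b => X (a, b)) μ :=
  hX.aestronglyMeasurable.integral_prod_right'.aemeasurable.congr
    ((ae_lowerMean_eq_integral hX).mono fun _ => Eq.symm)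

lemma integral_lowerMean (hX : Integrable X (μ.prod ν)) :
    ∫ a, lowerMean ν (fun b => X (a, b)) ∂μ = ∫ p, X p ∂(μ.prod ν) := by
  rw [integral_congr_ae (ae_lowerMean_eq_integral hX), integral_prod _ hX]

end LowerMean

section McDiarmid

universe u

/-- Replacing the `i`-th coordinate of a point increases the value of `f` by at most `c i`. -/
def HasBoundedDifferences {ι : Type*} [DecidableEq ι] {E : ι → Type*} (f : (∀ i, E i) → ℝ)
    (c : ι → ℝ) : Prop :=
  ∀ S i x, f (Function.update S i x) ≤ f S + c i

namespace HasBoundedDifferences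

variable {ι : Type*} [DecidableEq ι] {E : ι → Type*} {f : (∀ i, E i) → ℝ} {c : ι → ℝ}

lemma le_add_sum [Fintype ι] (hf : HasBoundedDifferences f c) (S T : ∀ i, E i) :
    f S ≤ f T + ∑ i, c i := by
  have h : ∀ s : Finset ι, f (s.piecewise S T) ≤ f T + ∑ i ∈ s, c i := fun s => by
    induction s using Finset.induction_on with
    | empty => simp
    | insert i s hi ih =>
      rw [Finset.piecewise_insert, Finset.sum_insert hi]
      linarith [hf (s.piecewise S T) i (S i)]
  simpa using h Finset.univ

lemma bddAbove_range [Finite ι] [Nonempty (∀ i, E i)] (hf : HasBoundedDifferences f c) :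
    BddAbove (range f) := by
  cases nonempty_fintype ι
  exact ⟨f (Classical.arbitrary _) + ∑ i, c i, forall_mem_range.2 fun S => hf.le_add_sum S _⟩

lemma bddBelow_range [Finite ι] [Nonempty (∀ i, E i)] (hf : HasBoundedDifferences f c) :
    BddBelow (range f) := by
  cases nonempty_fintype ι
  exact ⟨f (Classical.arbitrary _) - ∑ i, c i, forall_mem_range.2 fun S =>
    sub_le_iff_le_add.2 (hf.le_add_sum _ S)⟩

end HasBoundedDifferences

lemma hasSubgaussianMGF_prod {α β : Type*} [MeasurableSpace α] [MeasurableSpace β]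
    {μ : Measure α} {ν : Measure β} [SFinite μ] [SFinite ν] {X : α × β → ℝ} {Y : α → ℝ}
    {cX cY : ℝ≥0}
    (hX : AEMeasurable X (μ.prod ν)) (hY : HasSubgaussianMGF Y cY μ)
    (hXY : ∀ᵐ a ∂μ, HasSubgaussianMGF (fun b => X (a, b) - Y a) cX ν) :
    HasSubgaussianMGF X (cY + cX) (μ.prod ν) := by
  have hexp : ∀ t a b, Real.exp (t * X (a, b)) =
      Real.exp (t * Y a) * Real.exp (t * (X (a, b) - Y a)) := fun t a b => by
    rw [← Real.exp_add]; ring_nf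
  have hsection : ∀ t, ∀ᵐ a ∂μ, ∫ b, Real.exp (t * X (a, b)) ∂ν ≤
      Real.exp (t * Y a) * Real.exp (cX * t ^ 2 / 2) := fun t => by
    filter_upwards [hXY] with a ha
    simp only [hexp, integral_const_mul]
    exact mul_le_mul_of_nonneg_left (ha.mgf_le t) (Real.exp_pos _).le
  have hmeas : ∀ t, AEStronglyMeasurable (fun p => Real.exp (t * X p)) (μ.prod ν) := fun t =>
    (Real.measurable_exp.comp_aemeasurable (hX.const_mul t)).aestronglyMeasurable
  have hint : ∀ t, Integrable (fun p => Real.exp (t * X p)) (μ.prod ν) := fun t => by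
    refine (integrable_prod_iff (hmeas t)).2 ⟨?_, ?_⟩
    · filter_upwards [hXY] with a ha
      simpa only [hexp] using (ha.integrable_exp_mul t).const_mul _
    · simp only [Real.norm_of_nonneg (Real.exp_pos _).le]
      refine ((hY.integrable_exp_mul t).mul_const (Real.exp (cX * t ^ 2 / 2))).mono'
        (hmeas t).integral_prod_right' ?_
      filter_upwards [hsection t] with a ha
      rwa [Real.norm_of_nonneg (integral_nonneg fun b => (Real.exp_pos _).le)]
  refine ⟨hint, fun t => ?_⟩
  calc ∫ p, Real.exp (t * X p) ∂(μ.prod ν)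
      ≤ ∫ a, Real.exp (t * Y a) * Real.exp (cX * t ^ 2 / 2) ∂μ := by
        rw [integral_prod _ (hint t)]
        exact integral_mono_ae (hint t).integral_prod_left
          ((hY.integrable_exp_mul t).mul_const _) (hsection t)
    _ ≤ Real.exp (cY * t ^ 2 / 2) * Real.exp (cX * t ^ 2 / 2) := by
        rw [integral_mul_const]
        exact mul_le_mul_of_nonneg_right (hY.mgf_le t) (Real.exp_pos _).le
    _ = Real.exp ((cY + cX : ℝ≥0) * t ^ 2 / 2) := by
        rw [← Real.exp_add]; push_cast; ring_nf

lemma hasSubgaussianMGF_of_le_add {Ω : Type*} [MeasurableSpace Ω] {ν : Measure Ω}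
    [IsProbabilityMeasure ν] {X : Ω → ℝ} {c : ℝ} (hX : AEMeasurable X ν)
    (hc : ∀ x y, X x ≤ X y + c) :
    HasSubgaussianMGF (fun x => X x - ∫ y, X y ∂ν) ((‖c‖₊ / 2) ^ 2) ν := by
  have : Nonempty Ω := nonempty_of_isProbabilityMeasure ν
  have hbdd : BddBelow (range X) := ⟨X (Classical.arbitrary _) - c,
    forall_mem_range.2 fun x => sub_le_iff_le_add.2 (hc _ x)⟩
  have hmem : ∀ x, X x ∈ Icc (⨅ y, X y) ((⨅ y, X y) + c) := fun x =>
    ⟨ciInf_le hbdd x, sub_le_iff_le_add.1 (le_ciInf fun y => sub_le_iff_le_add.2 (hc x y))⟩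
  simpa using hasSubgaussianMGF_of_mem_Icc hX (Eventually.of_forall hmem)

lemma HasBoundedDifferences.insertNth_le {n : ℕ} {E : Fin (n + 1) → Type*}
    {f : (∀ i, E i) → ℝ} {c : Fin (n + 1) → ℝ} (hf : HasBoundedDifferences f c) (i : Fin (n + 1))
    (x y : E i) (T : ∀ j, E (i.succAbove j)) :
    f (i.insertNth x T) ≤ f (i.insertNth y T) + c i := by
  simpa using hf (i.insertNth y T) i x

lemma HasBoundedDifferences.lowerMean_insertNth {n : ℕ} {E : Fin (n + 1) → Type*}
    {f : (∀ i, E i) → ℝ} {c : Fin (n + 1) → ℝ} (hf : HasBoundedDifferences f c) (i : Fin (n + 1))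
    [MeasurableSpace (E i)] (ν : Measure (E i)) [IsProbabilityMeasure ν] :
    HasBoundedDifferences (fun T => lowerMean ν fun x => f (i.insertNth x T))
      fun j => c (i.succAbove j) := by
  have : Nonempty (E i) := nonempty_of_isProbabilityMeasure ν
  let x₀ : E i := Classical.arbitrary _
  intro T j y
  refine lowerMean_le_add ⟨f (i.insertNth x₀ (Function.update T j y)) - c i,
    forall_mem_range.2 fun x => sub_le_iff_le_add.2 (hf.insertNth_le i _ _ _)⟩
    ⟨f (i.insertNth x₀ T) + c i, forall_mem_range.2 fun x => hf.insertNth_le i _ _ _⟩ fun x => ?_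
  rw [Fin.insertNth_update]
  exact hf _ _ _

lemma HasBoundedDifferences.integrable {ι : Type*} [Fintype ι] [DecidableEq ι] {E : ι → Type*}
    [∀ i, MeasurableSpace (E i)] {μ : ∀ i, Measure (E i)} [∀ i, IsProbabilityMeasure (μ i)]
    {f : (∀ i, E i) → ℝ} {c : ι → ℝ} (hc : HasBoundedDifferences f c)
    (hf : AEMeasurable f (Measure.pi μ)) : Integrable f (Measure.pi μ) := by
  have : Nonempty (∀ i, E i) := nonempty_of_isProbabilityMeasure (Measure.pi μ)
  obtain ⟨a, ha⟩ := hc.bddBelow_range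
  obtain ⟨b, hb⟩ := hc.bddAbove_range
  exact Integrable.of_mem_Icc a b hf (Eventually.of_forall fun S =>
    ⟨ha (mem_range_self S), hb (mem_range_self S)⟩)

theorem hasSubgaussianMGF_of_hasBoundedDifferences {n : ℕ} {E : Fin n → Type u}
    [∀ i, MeasurableSpace (E i)] {μ : ∀ i, Measure (E i)} [∀ i, IsProbabilityMeasure (μ i)]
    {f : (∀ i, E i) → ℝ} {c : Fin n → ℝ} (hf : AEMeasurable f (Measure.pi μ))
    (hc : HasBoundedDifferences f c) :
    HasSubgaussianMGF (fun S => f S - ∫ T, f T ∂(Measure.pi μ)) (∑ i, (‖c i‖₊ / 2) ^ 2)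
      (Measure.pi μ) := by
  induction n with
  | zero =>
    have h0 : (fun S => f S - ∫ T, f T ∂(Measure.pi μ)) = fun _ => 0 := by
      funext S
      simp [fun T => congrArg f (Subsingleton.elim T S)]
    rw [h0, Fin.sum_univ_zero]
    exact HasSubgaussianMGF.fun_zero
  | succ n ih =>
    let e := (MeasurableEquiv.piFinSuccAbove E 0).trans MeasurableEquiv.prodComm
    let ν := Measure.pi fun j => μ ((0 : Fin (n + 1)).succAbove j)
    have he : MeasurePreserving e (Measure.pi μ) (ν.prod (μ 0)) :=
      Measure.measurePreserving_swap.comp (measurePreserving_piFinSuccAbove μ 0)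
    have hX : AEMeasurable (f ∘ e.symm) (ν.prod (μ 0)) :=
      hf.comp_quasiMeasurePreserving (he.symm e).quasiMeasurePreserving
    have hint : Integrable (f ∘ e.symm) (ν.prod (μ 0)) :=
      (he.symm e).integrable_comp_of_integrable (hc.integrable hf)
    have hmean : ∫ T, f T ∂(Measure.pi μ) =
        ∫ T, lowerMean (μ 0) (fun x => f (e.symm (T, x))) ∂ν :=
      ((he.symm e).integral_comp' f).symm.trans (integral_lowerMean hint).symm
    have hY := ih (aemeasurable_lowerMean hint) (hc.lowerMean_insertNth 0 (μ 0))
    have hsection : ∀ᵐ T ∂ν, HasSubgaussianMGF (fun x => f (e.symm (T, x)) -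
        lowerMean (μ 0) fun y => f (e.symm (T, y))) ((‖c 0‖₊ / 2) ^ 2) (μ 0) := by
      filter_upwards [ae_lowerMean_eq_integral hint, hint.prod_right_ae] with T hT hm
      rw [show lowerMean (μ 0) (fun y => f (e.symm (T, y))) = _ from hT]
      exact hasSubgaussianMGF_of_le_add hm.aemeasurable fun x y => hc.insertNth_le 0 x y T
    have hprod := hasSubgaussianMGF_prod (cX := (‖c 0‖₊ / 2) ^ 2)
      (hX.sub_const (∫ T, f T ∂(Measure.pi μ))) hY (by simpa [hmean, ν] using hsection)
    rw [← he.map_eq] at hprod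
    simpa only [Function.comp_def, e.symm_apply_apply, Fin.sum_univ_succAbove _ (0 : Fin (n + 1)),
      add_comm] using hprod.of_map e.measurable.aemeasurable

theorem measure_ge_le_of_hasBoundedDifferences {n : ℕ} {E : Fin n → Type u}
    [∀ i, MeasurableSpace (E i)] {μ : ∀ i, Measure (E i)} [∀ i, IsProbabilityMeasure (μ i)]
    {f : (∀ i, E i) → ℝ} {c : Fin n → ℝ} (hf : AEMeasurable f (Measure.pi μ))
    (hc : HasBoundedDifferences f c) {ε : ℝ} (hε : 0 ≤ ε) :
    (Measure.pi μ).real {S | ε ≤ f S - ∫ T, f T ∂(Measure.pi μ)} ≤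
      Real.exp (-(2 * ε ^ 2) / ∑ i, c i ^ 2) := by
  refine ((hasSubgaussianMGF_of_hasBoundedDifferences hf hc).measure_ge_le hε).trans_eq ?_
  congr 1
  push_cast
  simp only [div_pow, ← Finset.sum_div, Real.norm_eq_abs, sq_abs]
  field_simp

end McDiarmid

instance {E : Type*} [MeasurableSpace E] (P : Measure E) [IsProbabilityMeasure P] (n : ℕ) :
    IsProbabilityMeasure (sampleLaw P n) := by
  unfold sampleLaw; infer_instance

section Contraction

@[simp] lemma sgn_one : sgn 1 = 1 := by simp [sgn]

@[simp] lemma sgn_neg (y : ℤˣ) : sgn (-y) = -sgn y := by simp [sgn]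

@[simp] lemma abs_sgn (y : ℤˣ) : |sgn y| = 1 := by
  rcases Int.units_eq_one_or y with rfl | rfl <;> simp

variable {ι : Type*} {b u v : ι → ℝ}

lemma bddAbove_range_add_of_abs_sub_le
    (h₁ : BddAbove (range fun g => b g + u g)) (h₂ : BddAbove (range fun g => b g - u g))
    (huv : ∀ g h, |v g - v h| ≤ |u g - u h|) : BddAbove (range fun g => b g + v g) := by
  rcases isEmpty_or_nonempty ι with _ | ⟨⟨h⟩⟩
  · simp [range_eq_empty]
  obtain ⟨B₁, hB₁⟩ := h₁
  obtain ⟨B₂, hB₂⟩ := h₂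
  refine ⟨max (B₁ - u h) (B₂ + u h) + v h, forall_mem_range.2 fun g => ?_⟩
  have hg₁ : b g + u g ≤ B₁ := hB₁ (mem_range_self g)
  have hg₂ : b g - u g ≤ B₂ := hB₂ (mem_range_self g)
  have hv : v g - v h ≤ |u g - u h| := (le_abs_self _).trans (huv g h)
  rcases abs_cases (u g - u h) with ⟨e, _⟩ | ⟨e, _⟩
  · linarith [le_max_left (B₁ - u h) (B₂ + u h)]
  · linarith [le_max_right (B₁ - u h) (B₂ + u h)]

lemma iSup_add_add_iSup_sub_le [Nonempty ι]
    (h₁ : BddAbove (range fun g => b g + u g)) (h₂ : BddAbove (range fun g => b g - u g))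
    (huv : ∀ g h, |v g - v h| ≤ |u g - u h|) :
    (⨆ g, (b g + v g)) + (⨆ g, (b g - v g)) ≤ (⨆ g, (b g + u g)) + ⨆ g, (b g - u g) := by
  refine ciSup_add_ciSup_le fun g h => ?_
  have hv : v g - v h ≤ |u g - u h| := (le_abs_self _).trans (huv g h)
  rcases abs_cases (u g - u h) with ⟨e, _⟩ | ⟨e, _⟩
  · linarith [le_ciSup h₁ g, le_ciSup h₂ h]
  · linarith [le_ciSup h₁ h, le_ciSup h₂ g]

lemma sum_signs_succ {M : Type*} [AddCommMonoid M] {n : ℕ} (F : (Fin (n + 1) → ℤˣ) → M) :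
    ∑ σ, F σ = ∑ τ : Fin n → ℤˣ, (F (Fin.cons 1 τ) + F (Fin.cons (-1) τ)) := by
  rw [← (Fin.consEquiv fun _ : Fin (n + 1) => ℤˣ).sum_comp, Fintype.sum_prod_type,
    Finset.sum_comm]
  refine Finset.sum_congr rfl fun τ _ => ?_
  rw [UnitsInt.univ, Finset.sum_pair (by decide)]
  rfl

theorem sum_signs_iSup_le [Nonempty ι] {n : ℕ} {b : ι → ℝ} {u v : Fin n → ι → ℝ}
    (hu : ∀ σ : Fin n → ℤˣ, BddAbove (range fun g => b g + ∑ i, sgn (σ i) * u i g))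
    (huv : ∀ i g h, |v i g - v i h| ≤ |u i g - u i h|) :
    ∑ σ : Fin n → ℤˣ, (⨆ g, (b g + ∑ i, sgn (σ i) * v i g)) ≤
      ∑ σ : Fin n → ℤˣ, ⨆ g, (b g + ∑ i, sgn (σ i) * u i g) := by
  induction n generalizing b with
  | zero => simp
  | succ n ih =>
    let w (τ : Fin n → ℤˣ) (g : ι) : ℝ := b g + ∑ i, sgn (τ i) * u i.succ g
    have hadd : ∀ τ, BddAbove (range fun g => w τ g + u 0 g) := fun τ => by
      simpa [w, Fin.sum_univ_succ, add_assoc, add_comm, add_left_comm] using hu (Fin.cons 1 τ)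
    have hsub : ∀ τ, BddAbove (range fun g => w τ g - u 0 g) := fun τ => by
      simpa [w, Fin.sum_univ_succ, sub_eq_add_neg, add_assoc, add_comm, add_left_comm] using
        hu (Fin.cons (-1) τ)
    have hneg : ∀ g h, |-v 0 g - -v 0 h| ≤ |u 0 g - u 0 h| := fun g h => by
      rw [neg_sub_neg, abs_sub_comm]
      exact huv 0 g h
    have htail_add := ih (b := fun g => b g + v 0 g) (u := fun i => u i.succ)
      (fun τ => by simpa only [w, add_right_comm] using
        bddAbove_range_add_of_abs_sub_le (hadd τ) (hsub τ) (huv 0)) fun i => huv i.succ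
    have htail_sub := ih (b := fun g => b g - v 0 g) (u := fun i => u i.succ)
      (fun τ => by simpa only [w, sub_eq_add_neg, add_right_comm] using
        bddAbove_range_add_of_abs_sub_le (hadd τ) (hsub τ) hneg) fun i => huv i.succ
    calc ∑ σ : Fin (n + 1) → ℤˣ, (⨆ g, (b g + ∑ i, sgn (σ i) * v i g))
        = ∑ τ : Fin n → ℤˣ, (⨆ g, (b g + v 0 g + ∑ i, sgn (τ i) * v i.succ g)) +
            ∑ τ : Fin n → ℤˣ, (⨆ g, (b g - v 0 g + ∑ i, sgn (τ i) * v i.succ g)) := by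
          rw [sum_signs_succ, Finset.sum_add_distrib]
          simp [Fin.sum_univ_succ, sub_eq_add_neg, add_assoc]
      _ ≤ ∑ τ : Fin n → ℤˣ, (⨆ g, (b g + v 0 g + ∑ i, sgn (τ i) * u i.succ g)) +
            ∑ τ : Fin n → ℤˣ, (⨆ g, (b g - v 0 g + ∑ i, sgn (τ i) * u i.succ g)) :=
          add_le_add htail_add htail_sub
      _ = ∑ τ : Fin n → ℤˣ, ((⨆ g, (w τ g + v 0 g)) + ⨆ g, (w τ g - v 0 g)) := by
          simp only [Finset.sum_add_distrib, w, sub_eq_add_neg, add_right_comm]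
      _ ≤ ∑ τ : Fin n → ℤˣ, ((⨆ g, (w τ g + u 0 g)) + ⨆ g, (w τ g - u 0 g)) :=
          Finset.sum_le_sum fun τ _ => iSup_add_add_iSup_sub_le (hadd τ) (hsub τ) (huv 0)
      _ = ∑ σ : Fin (n + 1) → ℤˣ, ⨆ g, (b g + ∑ i, sgn (σ i) * u i g) := by
          rw [sum_signs_succ]
          simp [w, Fin.sum_univ_succ, sub_eq_add_neg, add_comm, add_left_comm]

end Contraction

section Sampling

variable {E : Type*} [MeasurableSpace E]

lemma measurePreserving_append (P : Measure E) [IsProbabilityMeasure P] (m n : ℕ) :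
    MeasurePreserving (fun p : (Fin m → E) × (Fin n → E) => Fin.append p.1 p.2)
      ((sampleLaw P m).prod (sampleLaw P n)) (sampleLaw P (m + n)) := by
  have h := (measurePreserving_piCongrLeft (fun _ : Fin (m + n) => P) finSumFinEquiv).comp
    (measurePreserving_sumPiEquivProdPi_symm fun _ : Fin m ⊕ Fin n => P)
  change MeasurePreserving _ ((Measure.pi _).prod (Measure.pi _)) (Measure.pi _)
  convert h using 1
  ext p i
  refine Fin.addCases (fun j => ?_) (fun j => ?_) i
  · exact (Fin.append_left p.1 p.2 j).trans (MeasurableEquiv.piCongrLeft_apply_apply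
      (β := fun _ => E) finSumFinEquiv ((MeasurableEquiv.sumPiEquivProdPi _).symm p) (.inl j)).symm
  · exact (Fin.append_right p.1 p.2 j).trans (MeasurableEquiv.piCongrLeft_apply_apply
      (β := fun _ => E) finSumFinEquiv ((MeasurableEquiv.sumPiEquivProdPi _).symm p) (.inr j)).symm

/-- Exchange the `i`-th points of two samples wherever `σ i = -1`. -/
def exchange {n : ℕ} (σ : Fin n → ℤˣ) (p : (Fin n → E) × (Fin n → E)) :
    (Fin n → E) × (Fin n → E) :=
  (fun i => if σ i = 1 then p.1 i else p.2 i, fun i => if σ i = 1 then p.2 i else p.1 i)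

lemma measurePreserving_exchange (P : Measure E) [IsProbabilityMeasure P] {n : ℕ}
    (σ : Fin n → ℤˣ) :
    MeasurePreserving (exchange σ) ((sampleLaw P n).prod (sampleLaw P n))
      ((sampleLaw P n).prod (sampleLaw P n)) := by
  have he := measurePreserving_arrowProdEquivProdArrow E E (Fin n) (fun _ => P) (fun _ => P)
  have hswap : ∀ i, MeasurePreserving (fun q : E × E => if σ i = 1 then q else q.swap)
      (P.prod P) (P.prod P) := fun i => by
    by_cases h : σ i = 1
    · simpa only [h, if_true] using! MeasurePreserving.id (P.prod P)
    · simpa [h] using Measure.measurePreserving_swap (μ := P) (ν := P)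
  have h := (he.comp (measurePreserving_pi (fun _ => P.prod P) (fun _ => P.prod P) hswap)).comp
    (he.symm _)
  change MeasurePreserving _ ((Measure.pi _).prod (Measure.pi _))
    ((Measure.pi _).prod (Measure.pi _))
  convert h using 1
  funext p
  ext i <;> by_cases h : σ i = 1 <;>
    simp [exchange, MeasurableEquiv.arrowProdEquivProdArrow, Equiv.arrowProdEquivProdArrow, h]

end Sampling

section Classes

variable {E : Type*}

/-- The composite class of the functions `x ↦ φ x (g x)`, for `g ∈ G`. -/
def compClass (φ : E → ℝ → ℝ) (G : Set (E → ℝ)) : Set (E → ℝ) :=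
  (fun g x => φ x (g x)) '' G

lemma iSup_compClass (φ : E → ℝ → ℝ) (G : Set (E → ℝ)) (F : (E → ℝ) → ℝ) :
    ⨆ h : compClass φ G, F h = ⨆ g : G, F fun x => φ x ((g : E → ℝ) x) :=
  (imageFactorization_surjective.iSup_comp (g := fun h : compClass φ G => F h)).symm

lemma HasMeasurableSups.compClass [MeasurableSpace E] {P : Measure E} {G : Set (E → ℝ)}
    {φ : E → ℝ → ℝ} (hG : HasMeasurableSups P G) (hφ : Measurable (Function.uncurry φ))
    (hφc : ∀ x, Continuous (φ x)) : HasMeasurableSups P (compClass φ G) := by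
  intro m ψ hψ hψc
  have h := hG m (fun i x z => ψ i x (φ x z))
    (fun i => (hψ i).comp (measurable_fst.prodMk hφ)) fun i x => (hψc i x).comp (hφc x)
  refine h.congr (.of_forall fun S => ?_)
  exact (iSup_compClass φ G fun g => ∑ i, ψ i (S i) (g (S i))).symm

/-- The Rademacher supremum of the class `H` on the sample `S`, for the signs `σ`. -/
noncomputable def signedSup (H : Set (E → ℝ)) {n : ℕ} (σ : Fin n → ℤˣ) (S : Fin n → E) : ℝ :=
  ⨆ h : H, (1 / (n : ℝ)) * ∑ i, sgn (σ i) * (h : E → ℝ) (S i)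

/-- The largest increase of the empirical mean of a member of `H` from the sample `S` to the
sample `T`. -/
noncomputable def supGap (H : Set (E → ℝ)) {n : ℕ} (S T : Fin n → E) : ℝ :=
  ⨆ h : H, (1 / (n : ℝ)) * ∑ i, ((h : E → ℝ) (T i) - (h : E → ℝ) (S i))

lemma abs_mean_le {n : ℕ} {y : Fin n → ℝ} {M : ℝ} (hy : ∀ i, |y i| ≤ M) :
    |(1 / (n : ℝ)) * ∑ i, y i| ≤ |M| := by
  have hsum : |∑ i, y i| ≤ n * |M| :=
    (Finset.abs_sum_le_sum_abs _ _).trans <|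
      (Finset.sum_le_sum fun i _ => (hy i).trans (le_abs_self M)).trans (by simp)
  rw [abs_mul, abs_of_nonneg (by positivity), one_div]
  refine (mul_le_mul_of_nonneg_left hsum (by positivity)).trans ?_
  rw [← mul_assoc]
  exact mul_le_of_le_one_left (abs_nonneg M) inv_mul_le_one

lemma abs_iSup_le {ι : Type*} {F : ι → ℝ} {C : ℝ} (hC : 0 ≤ C) (h : ∀ i, |F i| ≤ C) :
    |⨆ i, F i| ≤ C := by
  rcases isEmpty_or_nonempty ι with _ | ⟨⟨i⟩⟩
  · simpa using hC
  · have hbdd : BddAbove (range F) := ⟨C, forall_mem_range.2 fun i => (abs_le.1 (h i)).2⟩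
    exact abs_le.2 ⟨(abs_le.1 (h i)).1.trans (le_ciSup hbdd i),
      Real.iSup_le (fun i => (abs_le.1 (h i)).2) hC⟩

variable {H : Set (E → ℝ)} {M : ℝ} {n : ℕ}

lemma abs_signed_mean_le (hM : ∀ h ∈ H, ∀ x, |h x| ≤ M) (σ : Fin n → ℤˣ) (S : Fin n → E) (h : H) :
    |(1 / (n : ℝ)) * ∑ i, sgn (σ i) * (h : E → ℝ) (S i)| ≤ |M| :=
  abs_mean_le fun i => by simpa [abs_mul] using hM h h.2 (S i)

lemma abs_mean_gap_le (hM : ∀ h ∈ H, ∀ x, |h x| ≤ M) (S T : Fin n → E) (h : H) :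
    |(1 / (n : ℝ)) * ∑ i, ((h : E → ℝ) (T i) - (h : E → ℝ) (S i))| ≤ |M + M| :=
  abs_mean_le fun _ => (abs_sub _ _).trans (add_le_add (hM h h.2 _) (hM h h.2 _))

lemma le_signedSup (hM : ∀ h ∈ H, ∀ x, |h x| ≤ M) (σ : Fin n → ℤˣ) (S : Fin n → E) (h : H) :
    (1 / (n : ℝ)) * ∑ i, sgn (σ i) * (h : E → ℝ) (S i) ≤ signedSup H σ S :=
  le_ciSup (f := fun h : H => (1 / (n : ℝ)) * ∑ i, sgn (σ i) * (h : E → ℝ) (S i))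
    ⟨|M|, forall_mem_range.2 fun h => (abs_le.1 (abs_signed_mean_le hM σ S h)).2⟩ h

lemma le_supGap (hM : ∀ h ∈ H, ∀ x, |h x| ≤ M) (S T : Fin n → E) (h : H) :
    (1 / (n : ℝ)) * ∑ i, ((h : E → ℝ) (T i) - (h : E → ℝ) (S i)) ≤ supGap H S T :=
  le_ciSup (f := fun h : H => (1 / (n : ℝ)) * ∑ i, ((h : E → ℝ) (T i) - (h : E → ℝ) (S i)))
    ⟨|M + M|, forall_mem_range.2 fun h => (abs_le.1 (abs_mean_gap_le hM S T h)).2⟩ h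

lemma supGap_exchange_le [Nonempty H] (hM : ∀ h ∈ H, ∀ x, |h x| ≤ M) (σ : Fin n → ℤˣ)
    (p : (Fin n → E) × (Fin n → E)) :
    supGap H (exchange σ p).1 (exchange σ p).2 ≤ signedSup H σ p.2 + signedSup H (-σ) p.1 := by
  refine ciSup_le fun h => ?_
  refine le_trans (le_of_eq ?_) (add_le_add (le_signedSup hM σ p.2 h) (le_signedSup hM (-σ) p.1 h))
  rw [← mul_add, ← Finset.sum_add_distrib]
  congr 1
  refine Finset.sum_congr rfl fun i _ => ?_
  rcases Int.units_eq_one_or (σ i) with hi | hi <;> simp [exchange, hi] <;> ring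

lemma sum_signedSup_compClass_le {G : Set (E → ℝ)} [Nonempty G] {φ : E → ℝ → ℝ} {K : ℝ≥0}
    (hM : ∀ g ∈ G, ∀ x, |g x| ≤ M) (hK : ∀ x, LipschitzWith K (φ x)) (S : Fin n → E) :
    ∑ σ : Fin n → ℤˣ, signedSup (compClass φ G) σ S ≤
      K * ∑ σ : Fin n → ℤˣ, signedSup G σ S := by
  let u (i : Fin n) (g : G) : ℝ := 1 / (n : ℝ) * (K * (g : E → ℝ) (S i))
  let v (i : Fin n) (g : G) : ℝ := 1 / (n : ℝ) * φ (S i) ((g : E → ℝ) (S i))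
  have hv : ∀ σ : Fin n → ℤˣ,
      signedSup (compClass φ G) σ S = ⨆ g : G, (0 + ∑ i, sgn (σ i) * v i g) := fun σ => by
    rw [signedSup, iSup_compClass φ G fun h => 1 / (n : ℝ) * ∑ i, sgn (σ i) * h (S i)]
    simp only [v, zero_add, Finset.mul_sum, mul_left_comm]
  have hu : ∀ σ : Fin n → ℤˣ,
      K * signedSup G σ S = ⨆ g : G, (0 + ∑ i, sgn (σ i) * u i g) := fun σ => by
    rw [signedSup, Real.mul_iSup_of_nonneg K.coe_nonneg]
    simp only [u, zero_add, Finset.mul_sum, mul_left_comm]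
  have hbdd : ∀ σ : Fin n → ℤˣ, BddAbove (range fun g : G => 0 + ∑ i, sgn (σ i) * u i g) :=
    fun σ => ⟨K * |M|, forall_mem_range.2 fun g => by
      refine le_of_eq_of_le ?_ (mul_le_mul_of_nonneg_left
        (abs_le.1 (abs_signed_mean_le hM σ S g)).2 K.coe_nonneg)
      simp only [u, zero_add, Finset.mul_sum, mul_left_comm]⟩
  simp only [Finset.mul_sum, hu, hv]
  refine sum_signs_iSup_le hbdd fun i g h => ?_
  rw [← mul_sub, ← mul_sub, ← mul_sub, abs_mul, abs_mul, abs_mul, NNReal.abs_eq]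
  exact mul_le_mul_of_nonneg_left ((hK (S i)).dist_le_mul _ _) (abs_nonneg _)

end Classes

section Symmetrization

variable {E : Type*} [MeasurableSpace E] {P : Measure E} {H : Set (E → ℝ)} {M : ℝ} {n : ℕ}

lemma aemeasurable_signedSup (hH : HasMeasurableSups P H) (σ : Fin n → ℤˣ) :
    AEMeasurable (signedSup H σ) (sampleLaw P n) := by
  simpa only [funext fun S => signedSup.eq_1 H σ S, Finset.mul_sum] using
    hH n (fun i _ z => 1 / (n : ℝ) * (sgn (σ i) * z))
    (fun _ => (measurable_snd.const_mul _).const_mul _)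
    fun _ _ => (continuous_id.const_mul _).const_mul _

variable [IsProbabilityMeasure P]

lemma aemeasurable_supGap (hH : HasMeasurableSups P H) :
    AEMeasurable (fun p : (Fin n → E) × (Fin n → E) => supGap H p.1 p.2)
      ((sampleLaw P n).prod (sampleLaw P n)) := by
  let s : Fin (n + n) → ℤˣ := Fin.append (fun _ => -1) fun _ => 1
  have h := hH (n + n) (fun i _ z => 1 / (n : ℝ) * (sgn (s i) * z))
    (fun _ => (measurable_snd.const_mul _).const_mul _)
    fun _ _ => (continuous_id.const_mul _).const_mul _
  refine (h.comp_quasiMeasurePreserving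
    (measurePreserving_append P n n).quasiMeasurePreserving).congr (.of_forall fun p => ?_)
  simp only [Function.comp_apply, s, supGap, Fin.sum_univ_add, Fin.append_left, Fin.append_right,
    sgn_neg, sgn_one, neg_one_mul, one_mul, ← Finset.mul_sum, ← Finset.sum_add_distrib,
    neg_add_eq_sub]

lemma integrable_signedSup (hH : HasMeasurableSups P H) (hM : ∀ h ∈ H, ∀ x, |h x| ≤ M)
    (σ : Fin n → ℤˣ) : Integrable (signedSup H σ) (sampleLaw P n) :=
  .of_bound (aemeasurable_signedSup hH σ).aestronglyMeasurable |M|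
    (.of_forall fun S => abs_iSup_le (abs_nonneg M) (abs_signed_mean_le hM σ S))

lemma integrable_supGap (hH : HasMeasurableSups P H) (hM : ∀ h ∈ H, ∀ x, |h x| ≤ M) :
    Integrable (fun p : (Fin n → E) × (Fin n → E) => supGap H p.1 p.2)
      ((sampleLaw P n).prod (sampleLaw P n)) :=
  .of_bound (aemeasurable_supGap hH).aestronglyMeasurable |M + M|
    (.of_forall fun p => abs_iSup_le (abs_nonneg _) (abs_mean_gap_le hM p.1 p.2))

lemma rademacher_eq (hH : HasMeasurableSups P H) (hM : ∀ h ∈ H, ∀ x, |h x| ≤ M) :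
    rademacher P H n =
      (1 / (2 : ℝ) ^ n) * ∑ σ : Fin n → ℤˣ, ∫ S, signedSup H σ S ∂(sampleLaw P n) := by
  rw [← integral_finsetSum _ fun σ _ => integrable_signedSup hH hM σ, ← integral_const_mul]
  rfl

lemma rademacher_compClass_le {G : Set (E → ℝ)} [Nonempty G] {φ : E → ℝ → ℝ} {K : ℝ≥0} {C : ℝ}
    (hG : HasMeasurableSups P G) (hC : ∀ g ∈ G, ∀ x, |g x| ≤ C)
    (hφ : Measurable (Function.uncurry φ)) (hK : ∀ x, LipschitzWith K (φ x))
    (hM : ∀ h ∈ compClass φ G, ∀ x, |h x| ≤ M) :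
    rademacher P (compClass φ G) n ≤ K * rademacher P G n := by
  have hφG := hG.compClass hφ fun x => (hK x).continuous
  rw [rademacher_eq hG hC, rademacher_eq hφG hM, mul_left_comm]
  refine mul_le_mul_of_nonneg_left ?_ (by positivity)
  rw [← integral_finsetSum _ fun σ _ => integrable_signedSup hG hC σ,
    ← integral_finsetSum _ fun σ _ => integrable_signedSup hφG hM σ, ← integral_const_mul]
  exact integral_mono (integrable_finsetSum _ fun σ _ => integrable_signedSup hφG hM σ)
    ((integrable_finsetSum _ fun σ _ => integrable_signedSup hG hC σ).const_mul _)
    (sum_signedSup_compClass_le hC hK)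

lemma integral_supGap_le_add [Nonempty H] (hH : HasMeasurableSups P H)
    (hM : ∀ h ∈ H, ∀ x, |h x| ≤ M) (σ : Fin n → ℤˣ) :
    ∫ p, supGap H p.1 p.2 ∂((sampleLaw P n).prod (sampleLaw P n)) ≤
      ∫ S, signedSup H σ S ∂(sampleLaw P n) + ∫ S, signedSup H (-σ) S ∂(sampleLaw P n) := by
  have hex := measurePreserving_exchange P σ
  have hgap := integrable_supGap (n := n) hH hM
  have hsnd := (integrable_signedSup hH hM σ).comp_snd (sampleLaw P n)
  have hfst := (integrable_signedSup hH hM (-σ)).comp_fst (sampleLaw P n)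
  calc ∫ p, supGap H p.1 p.2 ∂((sampleLaw P n).prod (sampleLaw P n))
      = ∫ p, supGap H (exchange σ p).1 (exchange σ p).2
          ∂((sampleLaw P n).prod (sampleLaw P n)) := by
        conv_lhs => rw [← hex.map_eq]
        exact integral_map hex.aemeasurable (hex.map_eq.symm ▸ hgap.aestronglyMeasurable)
    _ ≤ ∫ p, (signedSup H σ p.2 + signedSup H (-σ) p.1)
          ∂((sampleLaw P n).prod (sampleLaw P n)) :=
        integral_mono (hex.integrable_comp_of_integrable hgap) (hsnd.add hfst)
          (supGap_exchange_le hM σ)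
    _ = _ := by
        rw [integral_add hsnd hfst, integral_fun_snd, integral_fun_fst]
        simp

theorem integral_supGap_le_rademacher [Nonempty H] (hH : HasMeasurableSups P H)
    (hM : ∀ h ∈ H, ∀ x, |h x| ≤ M) :
    ∫ p, supGap H p.1 p.2 ∂((sampleLaw P n).prod (sampleLaw P n)) ≤ 2 * rademacher P H n := by
  have hcard : (Finset.univ : Finset (Fin n → ℤˣ)).card = 2 ^ n := by simp
  have hneg : ∑ σ : Fin n → ℤˣ, ∫ S, signedSup H (-σ) S ∂(sampleLaw P n) =
      ∑ σ : Fin n → ℤˣ, ∫ S, signedSup H σ S ∂(sampleLaw P n) :=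
    Equiv.sum_comp (Equiv.neg _) fun σ : Fin n → ℤˣ => ∫ S, signedSup H σ S ∂(sampleLaw P n)
  have hsum := Finset.card_nsmul_le_sum Finset.univ _ _ fun σ _ =>
    integral_supGap_le_add (n := n) hH hM σ
  rw [Finset.sum_add_distrib, hneg, hcard, nsmul_eq_mul, ← two_mul] at hsum
  rw [rademacher_eq hH hM, mul_left_comm, one_div, ← div_eq_inv_mul, le_div_iff₀' (by positivity)]
  exact_mod_cast hsum

end Symmetrization

section UniformDeviation

variable {E : Type*} {H : Set (E → ℝ)} {a b M : ℝ} {n : ℕ}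

lemma abs_le_of_mem_Icc (hab : ∀ h ∈ H, ∀ x, h x ∈ Icc a b) :
    ∀ h ∈ H, ∀ x, |h x| ≤ max |a| |b| :=
  fun h hh x => abs_le_max_abs_abs (hab h hh x).1 (hab h hh x).2

lemma supGap_update_le [Nonempty H] (hab : ∀ h ∈ H, ∀ x, h x ∈ Icc a b) (S T : Fin n → E)
    (i : Fin n) (x : E) :
    supGap H (Function.update S i x) T ≤ supGap H S T + (b - a) / n := by
  refine ciSup_le fun h => ?_
  have hupdate : ∑ j, (h : E → ℝ) (Function.update S i x j) =
      ∑ j, (h : E → ℝ) (S j) + ((h : E → ℝ) x - (h : E → ℝ) (S i)) := by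
    rw [← sub_eq_iff_eq_add', ← Finset.sum_sub_distrib, Finset.sum_eq_single i]
    · simp only [Function.update_self]
    · intro j _ hj
      rw [Function.update_of_ne hj, sub_self]
    · simp
  have hgap := le_supGap (abs_le_of_mem_Icc hab) S T h
  have hdiff : (1 / (n : ℝ)) * ((h : E → ℝ) (S i) - (h : E → ℝ) x) ≤ (b - a) / n := by
    rw [one_div_mul_eq_div]
    gcongr
    · exact (hab h h.2 (S i)).2
    · exact (hab h h.2 x).1
  rw [Finset.sum_sub_distrib] at hgap ⊢
  rw [hupdate]
  linarith

variable [MeasurableSpace E] {P : Measure E}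

/-- The mean of `supGap H S T` over an independent sample `T`. It replaces the supremum over `H` of
the deviations from the true means, since `HasMeasurableSups` gives measurability only for suprema
of functions of sample points. -/
noncomputable def meanGap (P : Measure E) (H : Set (E → ℝ)) {n : ℕ} (S : Fin n → E) : ℝ :=
  lowerMean (sampleLaw P n) (supGap H S)

variable [IsProbabilityMeasure P]

lemma hasBoundedDifferences_meanGap [Nonempty H] (hab : ∀ h ∈ H, ∀ x, h x ∈ Icc a b) :
    HasBoundedDifferences (meanGap P H) fun _ : Fin n => (b - a) / n := by
  have hbdd : ∀ S : Fin n → E, BddBelow (range (supGap H S)) ∧ BddAbove (range (supGap H S)) :=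
    fun S => by
      have h := fun T => abs_le.1 <| abs_iSup_le (abs_nonneg _)
        (abs_mean_gap_le (abs_le_of_mem_Icc hab) S T)
      exact ⟨⟨_, forall_mem_range.2 fun T => (h T).1⟩, ⟨_, forall_mem_range.2 fun T => (h T).2⟩⟩
  exact fun S i x => lowerMean_le_add (hbdd _).1 (hbdd S).2 fun T => supGap_update_le hab S T i x

lemma mean_sub_le_integral_supGap {h : E → ℝ} (hM : ∀ h ∈ H, ∀ x, |h x| ≤ M) (hh : h ∈ H)
    (hint : Integrable h P) (hn : 0 < n) {S : Fin n → E}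
    (hgap : Integrable (supGap H S) (sampleLaw P n)) :
    ∫ x, h x ∂P - (1 / (n : ℝ)) * ∑ i, h (S i) ≤ ∫ T, supGap H S T ∂(sampleLaw P n) := by
  have heval : ∀ i : Fin n, Integrable (fun T : Fin n → E => h (T i)) (sampleLaw P n) :=
    fun i => integrable_comp_eval (μ := fun _ => P) hint
  have hmean : ∀ i : Fin n, ∫ T : Fin n → E, h (T i) ∂(sampleLaw P n) = ∫ x, h x ∂P :=
    fun i => integral_comp_eval (μ := fun _ => P) hint.aestronglyMeasurable
  have hsub : ∀ i : Fin n, Integrable (fun T : Fin n → E => h (T i) - h (S i)) (sampleLaw P n) :=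
    fun i => (heval i).sub (integrable_const _)
  calc ∫ x, h x ∂P - (1 / (n : ℝ)) * ∑ i, h (S i)
      = ∫ T, (1 / (n : ℝ)) * ∑ i, (h (T i) - h (S i)) ∂(sampleLaw P n) := by
        rw [integral_const_mul, integral_finsetSum _ fun i _ => hsub i]
        simp only [integral_sub (heval _) (integrable_const _), hmean, integral_const,
          probReal_univ, one_smul, Finset.sum_sub_distrib, Finset.sum_const, Finset.card_univ,
          Fintype.card_fin, nsmul_eq_mul]
        field_simp
    _ ≤ ∫ T, supGap H S T ∂(sampleLaw P n) :=
        integral_mono ((integrable_finsetSum _ fun i _ => hsub i).const_mul _) hgap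
          fun T => le_supGap hM S T ⟨h, hh⟩

lemma exp_neg_two_mul_sq_sqrt_log_le (hn : 0 < n) {δ : ℝ} (hδ : 0 < δ) :
    Real.exp (-(2 * n * √(Real.log (1 / δ) / (2 * n)) ^ 2)) ≤ δ := by
  have hn' : (0 : ℝ) < 2 * n := by positivity
  have hlog : Real.log (1 / δ) ≤ 2 * n * √(Real.log (1 / δ) / (2 * n)) ^ 2 := by
    rw [Real.sq_sqrt', ← div_le_iff₀' hn']
    exact le_max_left _ _
  rw [← Real.le_log_iff_exp_le hδ]
  simpa [neg_le] using hlog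

lemma measure_meanGap_ge_le [Nonempty H] (hH : HasMeasurableSups P H)
    (hab : ∀ h ∈ H, ∀ x, h x ∈ Icc a b) (hlt : a < b) (hn : 0 < n) {δ : ℝ} (hδ : 0 < δ) :
    (sampleLaw P n).real {S | (b - a) * √(Real.log (1 / δ) / (2 * n)) ≤
      meanGap P H S - ∫ T, meanGap P H T ∂(sampleLaw P n)} ≤ δ := by
  have hba : 0 < b - a := sub_pos.2 hlt
  have hgap := integrable_supGap (n := n) hH (abs_le_of_mem_Icc hab)
  refine (measure_ge_le_of_hasBoundedDifferences (aemeasurable_lowerMean hgap)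
    (hasBoundedDifferences_meanGap hab) (by positivity)).trans
      (le_of_eq_of_le ?_ (exp_neg_two_mul_sq_sqrt_log_le hn hδ))
  rw [Fin.sum_const, nsmul_eq_mul]
  congr 1
  field_simp

lemma exists_measurableSet_forall_and {Ω : Type*} [MeasurableSpace Ω] {μ : Measure Ω}
    {A : Set Ω} (hA : NullMeasurableSet A μ) {q : Ω → Prop} (hq : ∀ᵐ ω ∂μ, q ω) :
    ∃ A' ⊆ A, MeasurableSet A' ∧ μ.real A' = μ.real A ∧ ∀ ω ∈ A', q ω := by
  have hae : (A ∩ {ω | q ω} : Set Ω) =ᵐ[μ] A :=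
    inter_ae_eq_left_of_ae_eq_univ (eventuallyEq_univ.2 hq)
  obtain ⟨A', hsub, hmeas, heq⟩ := (hA.congr hae.symm).exists_measurable_subset_ae_eq
  exact ⟨A', hsub.trans inter_subset_left, hmeas, measureReal_congr (heq.trans hae),
    fun ω hω => (hsub hω).2⟩

theorem exists_forall_integral_le_mean_add [Nonempty H] (hH : HasMeasurableSups P H)
    (hHm : ∀ h ∈ H, Measurable h) (hab : ∀ h ∈ H, ∀ x, h x ∈ Icc a b) (hlt : a < b) (hn : 0 < n)
    {δ : ℝ} (hδ : 0 < δ) :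
    ∃ A : Set (Fin n → E), MeasurableSet A ∧ 1 - δ ≤ (sampleLaw P n).real A ∧
      ∀ S ∈ A, ∀ h ∈ H, ∫ x, h x ∂P ≤ (1 / (n : ℝ)) * ∑ i, h (S i) +
        (2 * rademacher P H n + (b - a) * √(Real.log (1 / δ) / (2 * n))) := by
  have hM := abs_le_of_mem_Icc hab
  have hgap := integrable_supGap (n := n) hH hM
  have hmean : ∫ S, meanGap P H S ∂(sampleLaw P n) ≤ 2 * rademacher P H n :=
    (integral_lowerMean hgap).trans_le (integral_supGap_le_rademacher hH hM)
  have hnull : NullMeasurableSet {S | (b - a) * √(Real.log (1 / δ) / (2 * n)) ≤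
      meanGap P H S - ∫ T, meanGap P H T ∂(sampleLaw P n)} (sampleLaw P n) :=
    nullMeasurableSet_le aemeasurable_const ((aemeasurable_lowerMean hgap).sub_const _)
  obtain ⟨A, hAsub, hAm, hAμ, hA⟩ := exists_measurableSet_forall_and hnull.compl
    (hgap.prod_right_ae.and (ae_lowerMean_eq_integral hgap))
  refine ⟨A, hAm, ?_, fun S hS h hh => ?_⟩
  · rw [hAμ, measureReal_compl₀ hnull, probReal_univ]
    linarith [measure_meanGap_ge_le (n := n) hH hab hlt hn hδ]
  · have hdev : meanGap P H S - ∫ T, meanGap P H T ∂(sampleLaw P n) <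
        (b - a) * √(Real.log (1 / δ) / (2 * n)) := not_le.1 (hAsub hS)
    have hint : Integrable h P := .of_mem_Icc a b (hHm h hh).aemeasurable (.of_forall (hab h hh))
    have hle := mean_sub_le_integral_supGap hM hh hint hn (hA S hS).1
    rw [← (hA S hS).2] at hle
    change _ ≤ meanGap P H S at hle
    linarith

end UniformDeviation

section RiskIdentity

variable {E : Type*} [MeasurableSpace E] {μ : Measure (E × ℤˣ)} {r : E → ℝ}

lemma measurableSet_positive : MeasurableSet (Prod.snd ⁻¹' {1} : Set (E × ℤˣ)) :=
  measurable_snd ⟨{1}, measurableSet_singleton 1, by ext y; simp⟩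

lemma map_restrict_positive (hr : IsConfidence μ r) :
    (μ.restrict (Prod.snd ⁻¹' {1})).map Prod.fst =
      μ.fst.withDensity fun x => ENNReal.ofReal (r x) := by
  ext A hA
  rw [Measure.map_apply measurable_fst hA, Measure.restrict_apply (measurable_fst hA),
    withDensity_apply _ hA, ← hr.measure_eq A hA, Set.prod_eq]

lemma integral_map_restrict_positive (hr : IsConfidence μ r) (h : E → ℝ) :
    ∫ x, h x ∂((μ.restrict (Prod.snd ⁻¹' {1})).map Prod.fst) = ∫ x, r x * h x ∂μ.fst := by
  rw [map_restrict_positive hr, integral_withDensity_eq_integral_toReal_smul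
    hr.measurable.ennreal_ofReal (.of_forall fun _ => ENNReal.ofReal_lt_top)]
  simp only [ENNReal.toReal_ofReal (hr.mem_Icc _).1, smul_eq_mul]

lemma prior_mul_integral_posDist (hr : IsConfidence μ r) (hπ : prior μ ≠ 0) (h : E → ℝ) :
    prior μ * ∫ x, h x ∂(posDist μ) = ∫ x, r x * h x ∂μ.fst := by
  rw [posDist, ProbabilityTheory.cond, Measure.map_smul, integral_smul_measure,
    integral_map_restrict_positive hr, ENNReal.toReal_inv, smul_eq_mul]
  exact mul_inv_cancel_left₀ hπ _

lemma posDist_absolutelyContinuous (μ : Measure (E × ℤˣ)) : posDist μ ≪ μ.fst :=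
  cond_absolutelyContinuous.map measurable_fst

lemma risk_eq_integral_fst {ℓ : ℝ → ℝ} {g : E → ℝ} (hr : IsConfidence μ r)
    (hp : Integrable (fun x => ℓ (g x)) μ.fst) (hm : Integrable (fun x => ℓ (-g x)) μ.fst) :
    risk μ ℓ g = ∫ x, (ℓ (-g x) + r x * (ℓ (g x) - ℓ (-g x))) ∂μ.fst := by
  have hsplit : ∀ p : E × ℤˣ, ℓ (sgn p.2 * g p.1) = ℓ (-g p.1) +
      (Prod.snd ⁻¹' {1}).indicator (fun q => ℓ (g q.1) - ℓ (-g q.1)) p := fun p => by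
    rcases Int.units_eq_one_or p.2 with hp | hp <;> simp [hp]
  have hr_norm : ∀ x, ‖r x‖ ≤ 1 := fun x => by
    rw [Real.norm_of_nonneg (hr.mem_Icc x).1]
    exact (hr.mem_Icc x).2
  have hdiff : Integrable (fun x => ℓ (g x) - ℓ (-g x)) μ.fst := hp.sub hm
  have hm_joint : Integrable (fun p : E × ℤˣ => ℓ (-g p.1)) μ :=
    hm.comp_measurable measurable_fst
  have hdiff_joint : Integrable (fun p : E × ℤˣ => ℓ (g p.1) - ℓ (-g p.1)) μ :=
    hdiff.comp_measurable measurable_fst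
  rw [risk, integral_congr_ae (.of_forall hsplit),
    integral_add hm_joint (hdiff_joint.indicator measurableSet_positive),
    integral_indicator measurableSet_positive,
    integral_add hm (hdiff.bdd_mul hr.measurable.aestronglyMeasurable (.of_forall hr_norm)),
    ← integral_map_restrict_positive hr]
  congr 1
  · exact (integral_map measurable_fst.aemeasurable hm.aestronglyMeasurable).symm
  · have hac : (μ.restrict (Prod.snd ⁻¹' {1})).map Prod.fst ≪ μ.fst :=
      Measure.restrict_le_self.absolutelyContinuous.map measurable_fst
    exact (integral_map measurable_fst.aemeasurable
      (hdiff.aestronglyMeasurable.mono_ac hac)).symm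

theorem risk_eq_prior_mul_integral {ℓ : ℝ → ℝ} {g : E → ℝ} (hr : IsConfidence μ r)
    (hπ : prior μ ≠ 0) (hr_ne : ∀ᵐ x ∂μ.fst, r x ≠ 0)
    (hp : Integrable (fun x => ℓ (g x)) μ.fst) (hm : Integrable (fun x => ℓ (-g x)) μ.fst) :
    risk μ ℓ g =
      prior μ * ∫ x, (ℓ (g x) + (1 - r x) / r x * ℓ (-g x)) ∂(posDist μ) := by
  rw [risk_eq_integral_fst hr hp hm, prior_mul_integral_posDist hr hπ]
  refine integral_congr_ae (hr_ne.mono fun x hx => ?_)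
  field_simp
  ring

variable [IsProbabilityMeasure μ] {Cr : ℝ}

lemma prior_pos (hr : IsConfidence μ r) (hCr : 0 < Cr) (hr_ge : ∀ᵐ x ∂μ.fst, Cr ≤ r x) :
    0 < prior μ := by
  have hle : ENNReal.ofReal Cr ≤ μ (Prod.snd ⁻¹' {1}) :=
    calc ENNReal.ofReal Cr = ∫⁻ _, ENNReal.ofReal Cr ∂μ.fst := by simp
      _ ≤ ∫⁻ x, ENNReal.ofReal (r x) ∂μ.fst :=
        lintegral_mono_ae (hr_ge.mono fun _ hx => ENNReal.ofReal_le_ofReal hx)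
      _ = μ (Prod.snd ⁻¹' {1}) := by
        rw [← setLIntegral_univ, ← hr.measure_eq univ .univ, univ_prod]
  exact ENNReal.toReal_pos ((ENNReal.ofReal_pos.2 hCr).trans_le hle).ne' (measure_ne_top _ _)

lemma isProbabilityMeasure_posDist (hπ : prior μ ≠ 0) : IsProbabilityMeasure (posDist μ) := by
  have : IsProbabilityMeasure (ProbabilityTheory.cond μ (Prod.snd ⁻¹' {1})) :=
    cond_isProbabilityMeasure fun h => hπ (by rw [prior, measureReal_def, h, ENNReal.toReal_zero])
  exact Measure.isProbabilityMeasure_map measurable_fst.aemeasurable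

end RiskIdentity

section PconfLoss

variable {E : Type*} {ℓ : ℝ → ℝ} {Cℓ Cr : ℝ} {L : ℝ≥0} {r : E → ℝ} {x : E}

/-- The weight `(1 - r) / r` of the loss of the negative label, with the denominator bounded below
by `Cr`. The confidence is at least `Cr` only almost everywhere, while the contraction and
bounded-difference arguments need bounds at every point. -/
noncomputable def negWeight (r : E → ℝ) (Cr : ℝ) (x : E) : ℝ :=
  (1 - r x) / max Cr (r x)

/-- The positive-confidence loss of the prediction `z` at `x`, whose mean under the law of positive
patterns is proportional to the classification risk. -/
noncomputable def pconfLoss (ℓ : ℝ → ℝ) (r : E → ℝ) (Cr : ℝ) (x : E) (z : ℝ) : ℝ :=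
  ℓ z + negWeight r Cr x * ℓ (-z)

lemma negWeight_mem_Icc (hCr : 0 < Cr) (hr : r x ∈ Icc (0 : ℝ) 1) :
    negWeight r Cr x ∈ Icc 0 (1 / Cr) :=
  ⟨div_nonneg (sub_nonneg.2 hr.2) (hr.1.trans (le_max_right _ _)),
    div_le_div₀ zero_le_one (sub_le_self 1 hr.1) hCr (le_max_left _ _)⟩

lemma pconfLoss_of_le (hx : Cr ≤ r x) (z : ℝ) :
    pconfLoss ℓ r Cr x z = ℓ z + (1 - r x) / r x * ℓ (-z) := by
  rw [pconfLoss, negWeight, max_eq_right hx]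

lemma pconfLoss_mem_Icc (hCr : 0 < Cr) (hr : r x ∈ Icc (0 : ℝ) 1)
    (hℓ : ∀ z, ℓ z ∈ Icc 0 Cℓ) (z : ℝ) : pconfLoss ℓ r Cr x z ∈ Icc 0 (Cℓ + Cℓ / Cr) := by
  have hw := negWeight_mem_Icc hCr hr
  refine ⟨add_nonneg (hℓ z).1 (mul_nonneg hw.1 (hℓ (-z)).1), add_le_add (hℓ z).2 ?_⟩
  rw [← one_div_mul_eq_div]
  exact mul_le_mul hw.2 (hℓ (-z)).2 (hℓ (-z)).1 (one_div_nonneg.2 hCr.le)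

lemma lipschitzWith_pconfLoss (hCr : 0 < Cr) (hr : r x ∈ Icc (0 : ℝ) 1)
    (hℓ : LipschitzWith L ℓ) : LipschitzWith (L + L / Cr.toNNReal) (pconfLoss ℓ r Cr x) := by
  have hw := negWeight_mem_Icc hCr hr
  have hneg : LipschitzWith (L / Cr.toNNReal) fun z => negWeight r Cr x * ℓ (-z) :=
    .of_dist_le_mul fun z z' => by
      have hz := hℓ.dist_le_mul (-z) (-z')
      rw [dist_neg_neg] at hz
      rw [NNReal.coe_div, Real.coe_toNNReal _ hCr.le, Real.dist_eq, ← mul_sub, abs_mul,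
        abs_of_nonneg hw.1, ← one_div_mul_eq_div, mul_assoc]
      exact mul_le_mul hw.2 hz (abs_nonneg _) (one_div_nonneg.2 hCr.le)
  exact hℓ.add hneg

lemma measurable_pconfLoss [MeasurableSpace E] (hr : Measurable r) (hℓ : Measurable ℓ) :
    Measurable (Function.uncurry (pconfLoss ℓ r Cr)) := by
  have hw : Measurable (negWeight r Cr) :=
    (measurable_const.sub hr).div (measurable_const.max hr)
  exact (hℓ.comp measurable_snd).add
    ((hw.comp measurable_fst).mul (hℓ.comp measurable_snd.neg))

variable [MeasurableSpace E] {μ : Measure (E × ℤˣ)} {g : E → ℝ}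

lemma empRisk_eq_prior_mul_mean {n : ℕ} {S : Fin n → E} (hS : ∀ i, Cr ≤ r (S i)) :
    empRisk μ r ℓ S g =
      prior μ * ((1 / (n : ℝ)) * ∑ i, pconfLoss ℓ r Cr (S i) (g (S i))) := by
  simp only [empRisk, pconfLoss_of_le (hS _)]

lemma risk_eq_prior_mul_integral_pconfLoss [IsProbabilityMeasure μ] (hr : IsConfidence μ r)
    (hCr : 0 < Cr) (hr_ge : ∀ᵐ x ∂μ.fst, Cr ≤ r x) (hℓm : Measurable ℓ)
    (hℓ : ∀ z, ℓ z ∈ Icc 0 Cℓ) (hg : Measurable g) :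
    risk μ ℓ g = prior μ * ∫ x, pconfLoss ℓ r Cr x (g x) ∂(posDist μ) := by
  rw [risk_eq_prior_mul_integral hr (prior_pos hr hCr hr_ge).ne'
    (hr_ge.mono fun _ hx => (hCr.trans_le hx).ne')
    (.of_mem_Icc 0 Cℓ (hℓm.comp hg).aemeasurable (.of_forall fun _ => hℓ _))
    (.of_mem_Icc 0 Cℓ (hℓm.comp hg.neg).aemeasurable (.of_forall fun _ => hℓ _))]
  congr 1
  refine integral_congr_ae ?_
  filter_upwards [(posDist_absolutelyContinuous μ).ae_le hr_ge] with x hx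
  exact (pconfLoss_of_le hx (g x)).symm

end PconfLoss

section UniformConvergence

variable {E : Type*} [MeasurableSpace E]

section CompositeClass

variable {P : Measure E} [IsProbabilityMeasure P] {G : Set (E → ℝ)} [Nonempty G]
  {φ : E → ℝ → ℝ} {C a b : ℝ} {K : ℝ≥0} {n : ℕ} {δ : ℝ}

lemma exists_forall_integral_comp_le_mean_add (hGsup : HasMeasurableSups P G)
    (hGmeas : ∀ g ∈ G, Measurable g) (hG : ∀ g ∈ G, ∀ x, |g x| ≤ C)
    (hφ : Measurable (Function.uncurry φ)) (hK : ∀ x, LipschitzWith K (φ x))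
    (hab : ∀ x z, φ x z ∈ Icc a b) (hlt : a < b) (hn : 0 < n) (hδ : 0 < δ) :
    ∃ A : Set (Fin n → E), MeasurableSet A ∧ 1 - δ ≤ (sampleLaw P n).real A ∧
      ∀ S ∈ A, ∀ g ∈ G, ∫ x, φ x (g x) ∂P ≤ (1 / (n : ℝ)) * ∑ i, φ (S i) (g (S i)) +
        (2 * (K * rademacher P G n) + (b - a) * √(Real.log (1 / δ) / (2 * n))) := by
  have : Nonempty (compClass φ G) := inferInstanceAs (Nonempty ((fun g x => φ x (g x)) '' G))
  have hmem : ∀ h ∈ compClass φ G, ∀ x, h x ∈ Icc a b := forall_mem_image.2 fun _ _ _ => hab _ _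
  have hmeas : ∀ h ∈ compClass φ G, Measurable h :=
    forall_mem_image.2 fun g hg => hφ.comp (measurable_id.prodMk (hGmeas g hg))
  obtain ⟨A, hAm, hAδ, hA⟩ := exists_forall_integral_le_mean_add
    (hGsup.compClass hφ fun x => (hK x).continuous) hmeas hmem hlt hn hδ
  have hrad := rademacher_compClass_le (n := n) hGsup hG hφ hK (abs_le_of_mem_Icc hmem)
  refine ⟨A, hAm, hAδ, fun S hS g hg => (hA S hS _ (mem_image_of_mem _ hg)).trans ?_⟩
  gcongr

theorem exists_forall_abs_mean_sub_integral_le (hGsup : HasMeasurableSups P G)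
    (hGmeas : ∀ g ∈ G, Measurable g) (hG : ∀ g ∈ G, ∀ x, |g x| ≤ C)
    (hφ : Measurable (Function.uncurry φ)) (hK : ∀ x, LipschitzWith K (φ x))
    (hab : ∀ x z, φ x z ∈ Icc a b) (hlt : a < b) (hn : 0 < n) (hδ : 0 < δ) :
    ∃ A : Set (Fin n → E), MeasurableSet A ∧ 1 - δ ≤ (sampleLaw P n).real A ∧
      ∀ S ∈ A, ∀ g ∈ G, |(1 / (n : ℝ)) * ∑ i, φ (S i) (g (S i)) - ∫ x, φ x (g x) ∂P| ≤
        2 * (K * rademacher P G n) + (b - a) * √(Real.log (2 / δ) / (2 * n)) := by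
  obtain ⟨A, hAm, hAδ, hA⟩ := exists_forall_integral_comp_le_mean_add hGsup hGmeas hG hφ hK
    hab hlt hn (half_pos hδ)
  obtain ⟨B, hBm, hBδ, hB⟩ := exists_forall_integral_comp_le_mean_add (φ := fun x z => -φ x z)
    hGsup hGmeas hG hφ.neg (fun x => (hK x).neg)
    (fun x z => ⟨neg_le_neg (hab x z).2, neg_le_neg (hab x z).1⟩) (neg_lt_neg hlt) hn (half_pos hδ)
  refine ⟨A ∩ B, hAm.inter hBm, ?_, fun S hS g hg => abs_le.2 ?_⟩
  · have hunion := measureReal_union_add_inter (μ := sampleLaw P n) (s := A) hBm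
    linarith [measureReal_le_one (μ := sampleLaw P n) (s := A ∪ B)]
  · have hupper := hA S hS.1 g hg
    have hlower := hB S hS.2 g hg
    rw [one_div_div] at hupper hlower
    rw [integral_neg, Finset.sum_neg_distrib, neg_sub_neg] at hlower
    constructor <;> linarith

end CompositeClass

lemma ae_forall_sample {P : Measure E} [IsProbabilityMeasure P] {p : E → Prop}
    (hp : ∀ᵐ x ∂P, p x) (n : ℕ) : ∀ᵐ S ∂(sampleLaw P n), ∀ i, p (S i) :=
  ae_all_iff.2 fun i => (Measure.quasiMeasurePreserving_eval _ i).ae hp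

lemma exists_lipschitzWith_eqOn_Icc {f : ℝ → ℝ} {K : ℝ≥0} {a b : ℝ} {t : Set ℝ} (hab : a ≤ b)
    (hf : LipschitzOnWith K f (Icc a b)) (ht : MapsTo f (Icc a b) t) :
    ∃ F : ℝ → ℝ, LipschitzWith K F ∧ (∀ z, F z ∈ t) ∧ EqOn F f (Icc a b) := by
  refine ⟨IccExtend hab ((Icc a b).domRestrict f), ?_, fun z => ht (projIcc a b hab z).2,
    fun z hz => IccExtend_of_mem hab _ hz⟩
  have hlip := hf.to_restrict.comp (LipschitzWith.projIcc hab)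
  rwa [mul_one] at hlip

variable {μ : Measure (E × ℤˣ)} {r : E → ℝ} {G : Set (E → ℝ)} {ℓ ℓ' : ℝ → ℝ} {g : E → ℝ}
  {C Cℓ Cr : ℝ} {L : ℝ≥0} {n : ℕ} {δ : ℝ}

lemma risk_congr (hℓ : EqOn ℓ ℓ' (Icc (-C) C)) (hg : ∀ x, |g x| ≤ C) :
    risk μ ℓ g = risk μ ℓ' g :=
  integral_congr_ae <| .of_forall fun p => hℓ <| abs_le.1 <| by
    rw [abs_mul, abs_sgn, one_mul]
    exact hg p.1

lemma empRisk_congr (hℓ : EqOn ℓ ℓ' (Icc (-C) C)) (hg : ∀ x, |g x| ≤ C) (S : Fin n → E) :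
    empRisk μ r ℓ S g = empRisk μ r ℓ' S g := by
  have hpos : ∀ x, ℓ (g x) = ℓ' (g x) := fun x => hℓ (abs_le.1 (hg x))
  have hneg : ∀ x, ℓ (-g x) = ℓ' (-g x) := fun x =>
    hℓ (abs_le.1 ((abs_neg (g x)).trans_le (hg x)))
  simp only [empRisk, hpos, hneg]

variable [IsProbabilityMeasure μ] [Nonempty G]

lemma exists_forall_abs_empRisk_sub_risk_le_of_lipschitzWith (hr : IsConfidence μ r)
    (hGmeas : ∀ g ∈ G, Measurable g) (hGsup : HasMeasurableSups (posDist μ) G) (hCℓ : 0 < Cℓ)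
    (hCr : 0 < Cr) (hG : ∀ g ∈ G, ∀ x, |g x| ≤ C) (hℓ : ∀ z, ℓ z ∈ Icc 0 Cℓ)
    (hℓ_lip : LipschitzWith L ℓ) (hr_ge : ∀ᵐ x ∂μ.fst, Cr ≤ r x) (hn : 0 < n) (hδ : 0 < δ) :
    ∃ A : Set (Fin n → E), MeasurableSet A ∧ 1 - δ ≤ (sampleLaw (posDist μ) n).real A ∧
      ∀ S ∈ A, ∀ g ∈ G, |empRisk μ r ℓ S g - risk μ ℓ g| ≤
        prior μ * (2 * ((L + L / Cr) * rademacher (posDist μ) G n) +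
          (Cℓ + Cℓ / Cr) * √(Real.log (2 / δ) / (2 * n))) := by
  have hπ := prior_pos hr hCr hr_ge
  have := isProbabilityMeasure_posDist hπ.ne'
  obtain ⟨A, hAm, hAδ, hA⟩ := exists_forall_abs_mean_sub_integral_le hGsup hGmeas hG
    (measurable_pconfLoss hr.measurable hℓ_lip.continuous.measurable)
    (fun x => lipschitzWith_pconfLoss hCr (hr.mem_Icc x) hℓ_lip)
    (fun x => pconfLoss_mem_Icc hCr (hr.mem_Icc x) hℓ) (by positivity) hn hδ
  obtain ⟨B, hBA, hBm, hBμ, hB⟩ := exists_measurableSet_forall_and hAm.nullMeasurableSet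
    (ae_forall_sample ((posDist_absolutelyContinuous μ).ae_le hr_ge) n)
  refine ⟨B, hBm, hBμ ▸ hAδ, fun S hS g hg => ?_⟩
  rw [empRisk_eq_prior_mul_mean (hB S hS), risk_eq_prior_mul_integral_pconfLoss hr hCr hr_ge
    hℓ_lip.continuous.measurable hℓ (hGmeas g hg), ← mul_sub, abs_mul, abs_of_pos hπ]
  have hdev := hA S (hBA hS) g hg
  rw [NNReal.coe_add, NNReal.coe_div, Real.coe_toNNReal _ hCr.le, sub_zero] at hdev
  exact mul_le_mul_of_nonneg_left hdev hπ.le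

theorem exists_forall_abs_empRisk_sub_risk_le (hr : IsConfidence μ r)
    (hGmeas : ∀ g ∈ G, Measurable g) (hGsup : HasMeasurableSups (posDist μ) G) (hCℓ : 0 < Cℓ)
    (hCr : 0 < Cr) (hG : ∀ g ∈ G, ∀ x, |g x| ≤ C) (hℓ : MapsTo ℓ (Icc (-C) C) (Icc 0 Cℓ))
    (hℓ_lip : LipschitzOnWith L ℓ (Icc (-C) C)) (hr_ge : ∀ᵐ x ∂μ.fst, Cr ≤ r x)
    (hn : 0 < n) (hδ : 0 < δ) :
    ∃ A : Set (Fin n → E), MeasurableSet A ∧ 1 - δ ≤ (sampleLaw (posDist μ) n).real A ∧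
      ∀ S ∈ A, ∀ g ∈ G, |empRisk μ r ℓ S g - risk μ ℓ g| ≤
        prior μ * (2 * ((L + L / Cr) * rademacher (posDist μ) G n) +
          (Cℓ + Cℓ / Cr) * √(Real.log (2 / δ) / (2 * n))) := by
  obtain ⟨⟨x, -⟩⟩ := nonempty_of_isProbabilityMeasure μ
  have hC : -C ≤ C := neg_le_self <|
    (abs_nonneg _).trans (hG _ (Classical.arbitrary G).2 x)
  obtain ⟨F, hF_lip, hF, hFℓ⟩ := exists_lipschitzWith_eqOn_Icc hC hℓ_lip hℓ
  obtain ⟨A, hAm, hAδ, hA⟩ := exists_forall_abs_empRisk_sub_risk_le_of_lipschitzWith hr hGmeas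
    hGsup hCℓ hCr hG hF hF_lip hr_ge hn hδ
  refine ⟨A, hAm, hAδ, fun S hS g hg => ?_⟩
  rw [empRisk_congr hFℓ.symm (hG g hg), risk_congr hFℓ.symm (hG g hg)]
  exact hA S hS g hg

end UniformConvergence

section Minimizers

lemma IsMinimizer.sub_le {E : Type*} {F Fhat : (E → ℝ) → ℝ} {G : Set (E → ℝ)} {g ghat : E → ℝ}
    {ε : ℝ} (hmin : IsMinimizer Fhat G ghat) (hdev : ∀ h ∈ G, |Fhat h - F h| ≤ ε) (hg : g ∈ G) :
    F ghat - F g ≤ 2 * ε := by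
  have hghat := (abs_le.1 (hdev ghat hmin.1)).1
  have hg_dev := (abs_le.1 (hdev g hg)).2
  linarith [hmin.2 g hg]

theorem exists_forall_isMinimizer_risk_sub_risk_le {E : Type*} [MeasurableSpace E]
    {μ : Measure (E × ℤˣ)} [IsProbabilityMeasure μ] {r : E → ℝ} {G : Set (E → ℝ)} {ℓ : ℝ → ℝ}
    {C Cℓ Cr : ℝ} {L : ℝ≥0} {gstar : E → ℝ} {n : ℕ} {δ : ℝ} (hr : IsConfidence μ r)
    (hGmeas : ∀ g ∈ G, Measurable g) (hGsup : HasMeasurableSups (posDist μ) G) (hCℓ : 0 < Cℓ)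
    (hCr : 0 < Cr) (hG : ∀ g ∈ G, ∀ x, |g x| ≤ C) (hℓ : MapsTo ℓ (Icc (-C) C) (Icc 0 Cℓ))
    (hℓ_lip : LipschitzOnWith L ℓ (Icc (-C) C)) (hr_ge : ∀ᵐ x ∂μ.fst, Cr ≤ r x)
    (hgstar : gstar ∈ G) (hn : 0 < n) (hδ : 0 < δ) :
    ∃ A : Set (Fin n → E), MeasurableSet A ∧ 1 - δ ≤ (sampleLaw (posDist μ) n).real A ∧
      ∀ S ∈ A, ∀ ghat, IsMinimizer (empRisk μ r ℓ S) G ghat →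
        risk μ ℓ ghat - risk μ ℓ gstar ≤
          4 * prior μ * (L + L / Cr) * rademacher (posDist μ) G n +
          2 * prior μ * (Cℓ + Cℓ / Cr) * √(Real.log (2 / δ) / (2 * n)) := by
  have : Nonempty G := ⟨⟨gstar, hgstar⟩⟩
  obtain ⟨A, hAm, hAδ, hA⟩ :=
    exists_forall_abs_empRisk_sub_risk_le hr hGmeas hGsup hCℓ hCr hG hℓ hℓ_lip hr_ge hn hδ
  exact ⟨A, hAm, hAδ, fun S hS ghat hmin =>
    (hmin.sub_le (hA S hS) hgstar).trans_eq (by ring)⟩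

lemma tendsto_sqrt_div_two_mul (a : ℝ) :
    Tendsto (fun n : ℕ => √(a / (2 * n))) atTop (𝓝 0) := by
  have h : Tendsto (fun n : ℕ => a / (2 * (n : ℝ))) atTop (𝓝 0) :=
    (tendsto_natCast_atTop_atTop.const_mul_atTop two_pos).const_div_atTop a
  simpa using h.sqrt

lemma tendsto_measure_zero_of_forall_exists_disjoint {α : Type*} {l : Filter α} {Ω : α → Type*}
    [∀ n, MeasurableSpace (Ω n)] {ν : ∀ n, Measure (Ω n)} [∀ n, IsProbabilityMeasure (ν n)]
    {B : ∀ n, Set (Ω n)}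
    (h : ∀ δ : ℝ, 0 < δ → ∀ᶠ n in l, ∃ A : Set (Ω n), MeasurableSet A ∧
      1 - δ ≤ (ν n).real A ∧ Disjoint (B n) A) :
    Tendsto (fun n => ν n (B n)) l (𝓝 0) := by
  have hreal : Tendsto (fun n => (ν n).real (B n)) l (𝓝 0) := by
    refine tendsto_order.2 ⟨fun c hc => .of_forall fun n => hc.trans_le measureReal_nonneg,
      fun c hc => ?_⟩
    filter_upwards [h _ (half_pos hc)] with n ⟨A, hAm, hA, hdisj⟩
    calc (ν n).real (B n) ≤ (ν n).real Aᶜ := measureReal_mono hdisj.subset_compl_right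
      _ = 1 - (ν n).real A := probReal_compl_eq_one_sub hAm
      _ < c := by linarith
  exact (ENNReal.tendsto_toReal_zero_iff fun n => measure_ne_top _ _).1 hreal

end Minimizers

end Pconf

theorem theorem2_general {E : Type*} [MeasurableSpace E]
    (μ : Measure (E × ℤˣ)) [IsProbabilityMeasure μ]
    (r : E → ℝ) (hr : Pconf.IsConfidence μ r)
    (G : Set (E → ℝ)) (hGmeas : ∀ g ∈ G, Measurable g)
    (hGsup : Pconf.HasMeasurableSups (Pconf.posDist μ) G)
    (ℓ : ℝ → ℝ) (Cg Cℓ Cr : ℝ) (L : ℝ≥0) (hCℓ : 0 < Cℓ) (hCr : 0 < Cr)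
    (hG : ∀ g ∈ G, ∀ x, |g x| ≤ Cg)
    (hℓ_nonneg : ∀ z ∈ Icc (-Cg) Cg, 0 ≤ ℓ z)
    (hℓ_le : ∀ z ∈ Icc (-Cg) Cg, ℓ z ≤ Cℓ)
    (hℓ_lip : LipschitzOnWith L ℓ (Icc (-Cg) Cg))
    (hr_ge : ∀ᵐ x ∂μ.fst, Cr ≤ r x)
    (gstar : E → ℝ) (hgstar : gstar ∈ G) :
    (∀ n : ℕ, 0 < n → ∀ δ : ℝ, 0 < δ →
      ∃ A : Set (Fin n → E), MeasurableSet A ∧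
        1 - δ ≤ (Pconf.sampleLaw (Pconf.posDist μ) n).real A ∧
        ∀ S ∈ A, ∀ ghat, Pconf.IsMinimizer (Pconf.empRisk μ r ℓ S) G ghat →
          Pconf.risk μ ℓ ghat - Pconf.risk μ ℓ gstar ≤
            4 * Pconf.prior μ * (L + L / Cr) * Pconf.rademacher (Pconf.posDist μ) G n +
            2 * Pconf.prior μ * (Cℓ + Cℓ / Cr) * √(Real.log (2 / δ) / (2 * n))) ∧
    (Tendsto (fun n => Pconf.rademacher (Pconf.posDist μ) G n) atTop (𝓝 0) →
      ∀ ε : ℝ, 0 < ε →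
        Tendsto (fun n : ℕ => Pconf.sampleLaw (Pconf.posDist μ) n
          {S | ∃ ghat, Pconf.IsMinimizer (Pconf.empRisk μ r ℓ S) G ghat ∧
            ε < Pconf.risk μ ℓ ghat - Pconf.risk μ ℓ gstar}) atTop (𝓝 0)) := by
  have hbound := fun (n : ℕ) (hn : 0 < n) (δ : ℝ) (hδ : 0 < δ) =>
    Pconf.exists_forall_isMinimizer_risk_sub_risk_le hr hGmeas hGsup hCℓ hCr hG
      (fun z hz => ⟨hℓ_nonneg z hz, hℓ_le z hz⟩) hℓ_lip hr_ge hgstar hn hδ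
  refine ⟨hbound, fun hrad ε hε => ?_⟩
  have := Pconf.isProbabilityMeasure_posDist (Pconf.prior_pos hr hCr hr_ge).ne'
  refine Pconf.tendsto_measure_zero_of_forall_exists_disjoint fun δ hδ => ?_
  have hlim := (hrad.const_mul (4 * Pconf.prior μ * (L + L / Cr))).add
    ((Pconf.tendsto_sqrt_div_two_mul (Real.log (2 / δ))).const_mul
      (2 * Pconf.prior μ * (Cℓ + Cℓ / Cr)))
  rw [mul_zero, mul_zero, add_zero] at hlim
  filter_upwards [hlim.eventually_lt_const hε, eventually_gt_atTop 0] with n hlt hn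
  obtain ⟨A, hAm, hAδ, hA⟩ := hbound n hn δ hδ
  refine ⟨A, hAm, hAδ, Set.disjoint_left.2 ?_⟩
  rintro S ⟨ghat, hmin, hgt⟩ hS
  exact (hlt.trans hgt).not_ge (hA S hS ghat hmin)

theorem theorem2 {d : ℕ}
    (μ : Measure (EuclideanSpace ℝ (Fin d) × ℤˣ)) [IsProbabilityMeasure μ]
    (r : EuclideanSpace ℝ (Fin d) → ℝ) (hr : Pconf.IsConfidence μ r)
    (G : Set (EuclideanSpace ℝ (Fin d) → ℝ)) (hGmeas : ∀ g ∈ G, Measurable g)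
    (hGsup : Pconf.HasMeasurableSups (Pconf.posDist μ) G)
    (ℓ : ℝ → ℝ) (Cg Cℓ Cr : ℝ) (L : ℝ≥0) (hCg : 0 < Cg) (hCℓ : 0 < Cℓ) (hCr : 0 < Cr)
    (hG : ∀ g ∈ G, ∀ x, |g x| ≤ Cg)
    (hℓ_nonneg : ∀ z ∈ Icc (-Cg) Cg, 0 ≤ ℓ z)
    (hℓ_le : ∀ z ∈ Icc (-Cg) Cg, ℓ z ≤ Cℓ)
    (hℓ_lip : LipschitzOnWith L ℓ (Icc (-Cg) Cg))
    (hr_ge : ∀ᵐ x ∂μ.fst, Cr ≤ r x)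
    (gstar : EuclideanSpace ℝ (Fin d) → ℝ)
    (hgstar : Pconf.IsMinimizer (Pconf.risk μ ℓ) G gstar) :
    (∀ n : ℕ, 0 < n → ∀ δ : ℝ, 0 < δ →
      ∃ A : Set (Fin n → EuclideanSpace ℝ (Fin d)), MeasurableSet A ∧
        1 - δ ≤ (Pconf.sampleLaw (Pconf.posDist μ) n).real A ∧
        ∀ S ∈ A, ∀ ghat, Pconf.IsMinimizer (Pconf.empRisk μ r ℓ S) G ghat →
          Pconf.risk μ ℓ ghat - Pconf.risk μ ℓ gstar ≤
            4 * Pconf.prior μ * (L + L / Cr) * Pconf.rademacher (Pconf.posDist μ) G n +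
            2 * Pconf.prior μ * (Cℓ + Cℓ / Cr) * √(Real.log (2 / δ) / (2 * n))) ∧
    (Tendsto (fun n => Pconf.rademacher (Pconf.posDist μ) G n) atTop (𝓝 0) →
      ∀ ε : ℝ, 0 < ε →
        Tendsto (fun n : ℕ => Pconf.sampleLaw (Pconf.posDist μ) n
          {S | ∃ ghat, Pconf.IsMinimizer (Pconf.empRisk μ r ℓ S) G ghat ∧
            ε < Pconf.risk μ ℓ ghat - Pconf.risk μ ℓ gstar}) atTop (𝓝 0)) :=
  theorem2_general μ r hr G hGmeas hGsup ℓ Cg Cℓ Cr L hCℓ hCr hG hℓ_nonneg hℓ_le hℓ_lip hr_ge gstar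
    hgstar.1
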